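/- For a positive integer $n$, a $B_n$-partition is a set partition $\pi$ of $\{1,2,\dots,n,-1,-2,\dots,-n\}$ such that for every block $B$ of $\pi$ the set $-B=\{-x : x\in B\}$ is also a block of $\pi$, and such that at most one block $B$ of $\pi$, called the zero-block, satisfies $B=-B$. Let $M_n$ be the number of all $B_n$-partitions and let $N_n$ be the number of $B_n$-partitions without zero-block. Then $$\frac{N_n}{M_n}\sim\sqrt{\frac{\log n}{2n}}\qquad (n\to\infty).$$ -/

import Mathlib

open scoped Pointwise

namespace TypeB

/-- The signed ground set `{1, …, n, -1, …, -n}`. -/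
noncomputable def ground (n : ℕ) : Finset ℤ := (Finset.Icc (-(n : ℤ)) (n : ℤ)).erase 0

/-- The block `B` satisfies `B = -B`, where `-B = {-x | x ∈ B}`. -/
def IsZeroBlock (B : Finset ℤ) : Prop := B = -B

/-- A set partition of `{±1, …, ±n}` is of type `B_n` if its set of blocks is closed under
`B ↦ -B` and it has at most one zero-block. (The blocks of a `Finpartition` are nonempty.) -/
def IsBPartition {n : ℕ} (π : Finpartition (ground n)) : Prop :=
  (∀ B ∈ π.parts, -B ∈ π.parts) ∧
    ∀ B ∈ π.parts, ∀ C ∈ π.parts, IsZeroBlock B → IsZeroBlock C → B = C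

/-- The number `M_n` of `B_n`-partitions. -/
noncomputable def M (n : ℕ) : ℕ :=
  Nat.card {π : Finpartition (ground n) // IsBPartition π}

/-- The number `N_n` of `B_n`-partitions without zero-block. -/
noncomputable def N (n : ℕ) : ℕ :=
  Nat.card {π : Finpartition (ground n) //
    IsBPartition π ∧ ∀ B ∈ π.parts, ¬ IsZeroBlock B}

end TypeB

/-!
Sort the odd maps from `{±1, …, ±n}` to `{-k, …, k}` by the partition into fibres. A `B_n`-partition
with `b` pairs of blocks `±B`, `B ≠ -B`, arises from `k (k - 1) ⋯ (k - b + 1) 2 ^ b` of them, and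
this has expectation `1` when `k` is replaced by a Poisson variable `K` of mean `1 / 2`. Since there
are `(2k + 1) ^ n` odd maps, of which `(2k) ^ n` have no zero, this gives the Dobiński formulas
`M n = E[(2K + 1) ^ n]` and `N n = E[(2K) ^ n]`.

Write `A c n = E[(2K + c) ^ n]` and `r c n = A c (n + 1) / A c n`. Jensen's inequality gives
`log A (c + σ) (n + 1) - log A c (n + 1) ≥ (n + 1) σ / (r c n + σ)`, while Stein's identity
`E[K g(K)] = E[g(K + 1)] / 2` gives `A (c + 2) n = A c (n + 1) - c A c n`. Together, for `σ = ±2`,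
they yield `r log r = 2n + O(log r)`, hence `r ~ 2n / log n` and `exp (-n / (r + O(1))) ~ 1 / √r`.
For `σ = ±1` the inequality squeezes `N / M` between two such exponentials.
-/

namespace TypeB

section Counting

lemma ncard_eq_sum_ncard_of_existsUnique {ι γ : Type*} [Fintype ι] {s : Set γ} (hs : s.Finite)
    {r : ι → γ → Prop} (h : ∀ a ∈ s, ∃! i, r i a) : s.ncard = ∑ i, {a ∈ s | r i a}.ncard := by
  have hunion : s = ⋃ i, {a ∈ s | r i a} := by
    ext a
    simp only [Set.mem_iUnion, Set.mem_ofPred_eq, exists_and_left]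
    exact ⟨fun ha => ⟨ha, (h a ha).exists⟩, And.left⟩
  have hdisj : Pairwise (Function.onFun Disjoint fun i => {a ∈ s | r i a}) := fun i j hij =>
    Set.disjoint_left.2 fun a ⟨ha, hi⟩ ⟨_, hj⟩ => hij ((h a ha).unique hi hj)
  conv_lhs => rw [hunion]
  rw [Set.ncard_iUnion_of_finite (fun i => hs.subset (Set.sep_subset _ _)) hdisj,
    finsum_eq_sum_of_fintype]

lemma ncard_forall_mem {ι γ : Type*} [Finite ι] (T : Finset γ) :
    {g : ι → γ | ∀ i, g i ∈ T}.ncard = T.card ^ Nat.card ι := by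
  classical
  have := Fintype.ofFinite ι
  have hset : {g : ι → γ | ∀ i, g i ∈ T} = (Fintype.piFinset fun _ : ι => T : Set (ι → γ)) := by
    ext g
    simp only [Set.mem_ofPred_eq, Finset.mem_coe, Fintype.mem_piFinset]
  rw [hset, Set.ncard_coe_finset, Fintype.card_piFinset, Finset.prod_const, Finset.card_univ,
    Nat.card_eq_fintype_card]

lemma natAbs_units_mul_natCast_succ (s : ℤˣ) (a : ℕ) :
    ((s : ℤ) * ((a : ℤ) + 1)).natAbs = a + 1 := by
  rw [Int.natAbs_mul, Int.units_natAbs, one_mul]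
  rfl

lemma units_mul_natCast_succ_inj {s t : ℤˣ} {a b : ℕ} :
    (s : ℤ) * ((a : ℤ) + 1) = t * ((b : ℤ) + 1) ↔ a = b ∧ s = t := by
  constructor
  · intro h
    obtain rfl : a = b := by
      simpa only [natAbs_units_mul_natCast_succ, add_left_inj] using congrArg Int.natAbs h
    exact ⟨rfl, Units.ext (mul_right_cancel₀ (by omega) h)⟩
  · rintro ⟨rfl, rfl⟩
    rfl

lemma exists_units_mul_natCast_succ {z : ℤ} (hz : z ≠ 0) :
    ∃ s : ℤˣ, (s : ℤ) * ((z.natAbs - 1 : ℕ) + 1) = z := by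
  obtain h | h := hz.lt_or_gt
  · refine ⟨-1, ?_⟩
    push_cast
    omega
  · refine ⟨1, ?_⟩
    push_cast
    omega

/-- The integer family with absolute values `e i + 1` and signs `s i`, for `p = (e, s)`: every
family of nonzero integers in `{-k, …, k}` with distinct absolute values arises once this way. -/
def signedFamily {ι : Type*} {k : ℕ} (p : (ι ↪ Fin k) × (ι → ℤˣ)) (i : ι) : ℤ :=
  p.2 i * ((p.1 i : ℕ) + 1)

lemma natAbs_signedFamily {ι : Type*} {k : ℕ} (p : (ι ↪ Fin k) × (ι → ℤˣ)) (i : ι) :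
    (signedFamily p i).natAbs = p.1 i + 1 :=
  natAbs_units_mul_natCast_succ _ _

lemma signedFamily_injective (ι : Type*) (k : ℕ) :
    (signedFamily : (ι ↪ Fin k) × (ι → ℤˣ) → ι → ℤ).Injective := fun p q h => by
  have h i := units_mul_natCast_succ_inj.1 (congrFun h i)
  exact Prod.ext (DFunLike.ext _ _ fun i => Fin.ext (h i).1) (funext fun i => (h i).2)

lemma range_signedFamily (ι : Type*) (k : ℕ) :
    Set.range (signedFamily : (ι ↪ Fin k) × (ι → ℤˣ) → ι → ℤ) =
      {g | (∀ i, (g i).natAbs ≤ k) ∧ (∀ i, g i ≠ 0) ∧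
        Function.Injective fun i => (g i).natAbs} := by
  ext g
  constructor
  · rintro ⟨p, rfl⟩
    have hval := natAbs_signedFamily p
    refine ⟨fun i => ?_, fun i => ?_, fun i j hij => ?_⟩
    · have := hval i
      omega
    · have := hval i
      omega
    · simp only [hval, add_left_inj] at hij
      exact p.1.injective (Fin.ext hij)
  · rintro ⟨hle, hne, hinj⟩
    choose s hs using fun i => exists_units_mul_natCast_succ (hne i)
    have hlt i : (g i).natAbs - 1 < k := by
      have := hle i
      have := hne i
      omega
    refine ⟨⟨⟨fun i => ⟨(g i).natAbs - 1, hlt i⟩, fun i j hij => hinj ?_⟩, s⟩, funext hs⟩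
    have := hne i
    have := hne j
    simp only [Fin.mk.injEq] at hij ⊢
    omega

lemma ncard_natAbs_injective {ι : Type*} [Finite ι] (k : ℕ) :
    {g : ι → ℤ | (∀ i, (g i).natAbs ≤ k) ∧ (∀ i, g i ≠ 0) ∧
      Function.Injective fun i => (g i).natAbs}.ncard =
      k.descFactorial (Nat.card ι) * 2 ^ Nat.card ι := by
  have := Fintype.ofFinite ι
  rw [← range_signedFamily, ← Set.image_univ,
    Set.ncard_image_of_injective _ (signedFamily_injective ι k), Set.ncard_univ, Nat.card_prod,
    Nat.card_eq_fintype_card, Fintype.card_embedding_eq, Fintype.card_fin, Nat.card_fun,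
    Nat.card_eq_fintype_card, Nat.card_eq_fintype_card, Fintype.card_units_int]

end Counting

section OddMaps

section Neg

variable {α : Type*} [Neg α]

lemma odd_apply_eq_zero {f : α → ℤ} (hf : f.Odd) {a : α} (ha : -a = a) : f a = 0 := by
  have h := hf a
  rw [ha] at h
  omega

/-- `H` consists of one element of each pair `{a, -a}` with `-a ≠ a`. -/
structure IsTransversal (H : Set α) : Prop where
  neg_notMem : ∀ a ∈ H, -a ∉ H
  mem_or_neg_mem : ∀ a, -a ≠ a → a ∈ H ∨ -a ∈ H

namespace IsTransversal

variable {H : Set α} {f : α → ℤ}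

lemma neg_ne_self (hH : IsTransversal H) {a : α} (ha : a ∈ H) : -a ≠ a := fun h =>
  hH.neg_notMem a ha (h.symm ▸ ha)

lemma trichotomy (hH : IsTransversal H) (a : α) : a ∈ H ∨ -a ∈ H ∨ -a = a := by
  by_cases ha : -a = a
  · exact .inr (.inr ha)
  · exact (hH.mem_or_neg_mem a ha).imp_right .inl

lemma injOn_domRestrict (hH : IsTransversal H) :
    Set.InjOn H.domRestrict {f : α → ℤ | f.Odd} := by
  intro f hf g hg hfg
  have hfg : ∀ a ∈ H, f a = g a := fun a ha => congrFun hfg ⟨a, ha⟩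
  funext a
  obtain ha | ha | ha := hH.trichotomy a
  · exact hfg a ha
  · rw [← neg_inj, ← hf, ← hg, hfg _ ha]
  · rw [odd_apply_eq_zero hf ha, odd_apply_eq_zero hg ha]

lemma natAbs_le_iff (hH : IsTransversal H) (hf : f.Odd) {k : ℕ} :
    (∀ a, (f a).natAbs ≤ k) ↔ ∀ a : H, (f a).natAbs ≤ k := by
  refine ⟨fun h a => h a, fun h a => ?_⟩
  obtain ha | ha | ha := hH.trichotomy a
  · exact h ⟨a, ha⟩
  · simpa [hf a] using h ⟨-a, ha⟩
  · simp [odd_apply_eq_zero hf ha]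

lemma forall_ne_zero_iff (hH : IsTransversal H) (hα : ∀ a : α, -a ≠ a) (hf : f.Odd) :
    (∀ a, f a ≠ 0) ↔ ∀ a : H, f a ≠ 0 := by
  refine ⟨fun h a => h a, fun h a => ?_⟩
  obtain ha | ha := hH.mem_or_neg_mem a (hα a)
  · exact h ⟨a, ha⟩
  · simpa [hf a] using h ⟨-a, ha⟩

lemma neg_eq_self_of_apply_eq_zero (hH : IsTransversal H) (hf : f.Odd) (hne : ∀ a : H, f a ≠ 0)
    {a : α} (ha : f a = 0) : -a = a := by
  obtain h | h | h := hH.trichotomy a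
  · exact absurd ha (hne ⟨a, h⟩)
  · exact absurd (by rw [hf, ha, neg_zero]) (hne ⟨-a, h⟩)
  · exact h

lemma eq_of_apply_eq (hH : IsTransversal H) (hf : f.Odd) (hne : ∀ a : H, f a ≠ 0)
    (hinj : Function.Injective fun a : H => (f a).natAbs) {a b : α} (ha : a ∈ H)
    (hab : f a = f b) : a = b := by
  obtain hb | hb | hb := hH.trichotomy b
  · exact congrArg Subtype.val (hinj (a₁ := ⟨a, ha⟩) (a₂ := ⟨b, hb⟩) (congrArg _ hab))
  · have h : a = -b := congrArg Subtype.val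
      (hinj (a₁ := ⟨a, ha⟩) (a₂ := ⟨-b, hb⟩) (by simp only [hab, hf b, Int.natAbs_neg]))
    have h0 : f a = 0 := by
      have := hf b
      rw [← h] at this
      omega
    exact absurd h0 (hne ⟨a, ha⟩)
  · exact absurd (hab.trans (odd_apply_eq_zero hf hb)) (hne ⟨a, ha⟩)

end IsTransversal

/-- The odd maps from `α` to `{-k, …, k}`. -/
def boundedOddMaps (α : Type*) [Neg α] (k : ℕ) : Set (α → ℤ) :=
  {f | f.Odd ∧ ∀ a, (f a).natAbs ≤ k}

lemma finite_boundedOddMaps [Finite α] (k : ℕ) : (boundedOddMaps α k).Finite :=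
  (Set.Finite.pi' fun _ => Set.finite_Icc (-(k : ℤ)) k).subset fun _ hf a => by
    have := hf.2 a
    rw [Set.mem_Icc]
    omega

end Neg

section InvolutiveNeg

variable {α β : Type*} [InvolutiveNeg α] [InvolutiveNeg β]

lemma exists_isTransversal (α : Type*) [InvolutiveNeg α] : ∃ H : Set α, IsTransversal H := by
  classical
  let : LinearOrder α := linearOrderOfSTO WellOrderingRel
  refine ⟨{a | a < -a}, fun a ha => ?_, fun a ha => ?_⟩
  · simpa using (show a < -a from ha).le
  · simpa using ha.lt_or_gt.symm

namespace IsTransversal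

variable {H : Set α} {f : α → ℤ}

open Classical in
lemma surjOn_domRestrict (hH : IsTransversal H) :
    Set.SurjOn H.domRestrict {f : α → ℤ | f.Odd} Set.univ := by
  intro g _
  refine ⟨fun a => if ha : a ∈ H then g ⟨a, ha⟩ else if ha : -a ∈ H then -g ⟨-a, ha⟩ else 0,
    fun a => ?_, funext fun a => dif_pos a.2⟩
  by_cases ha : a ∈ H
  · simp [ha, hH.neg_notMem a ha]
  · by_cases ha' : -a ∈ H <;> simp [ha, ha']

lemma ncard_odd (hH : IsTransversal H) (R : Set (H → ℤ)) :
    {f : α → ℤ | f.Odd ∧ H.domRestrict f ∈ R}.ncard = R.ncard := by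
  have hbij : Set.BijOn H.domRestrict {f : α → ℤ | f.Odd} Set.univ :=
    ⟨Set.mapsTo_univ _ _, hH.injOn_domRestrict, hH.surjOn_domRestrict⟩
  exact (hbij.subset_right (Set.subset_univ R)).ncard_eq

lemma odd_injective_iff (hH : IsTransversal H) (hα : ∀ a b : α, -a = a → -b = b → a = b)
    (hf : f.Odd) :
    f.Injective ↔ (∀ a : H, f a ≠ 0) ∧ Function.Injective fun a : H => (f a).natAbs := by
  constructor
  · intro hinj
    refine ⟨fun a ha => hH.neg_ne_self a.2 (hinj ?_), fun a b hab => ?_⟩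
    · rw [hf, ha, neg_zero]
    · obtain h | h := Int.natAbs_eq_natAbs_iff.1 hab
      · exact Subtype.ext (hinj h)
      · rw [← hf] at h
        exact absurd (hinj h ▸ a.2) (hH.neg_notMem b b.2)
  · rintro ⟨hne, hinj⟩ a b hab
    obtain ha | ha | ha := hH.trichotomy a
    · exact hH.eq_of_apply_eq hf hne hinj ha hab
    · exact neg_injective (hH.eq_of_apply_eq hf hne hinj ha (by rw [hf, hf, hab]))
    · exact hα a b ha (hH.neg_eq_self_of_apply_eq_zero hf hne (hab ▸ odd_apply_eq_zero hf ha))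

end IsTransversal

lemma mem_Icc_neg_natCast {z : ℤ} {k : ℕ} : z ∈ Finset.Icc (-(k : ℤ)) k ↔ z.natAbs ≤ k := by
  rw [Finset.mem_Icc]
  omega

lemma IsTransversal.ncard_boundedOddMaps [Finite α] {H : Set α} (hH : IsTransversal H) (k : ℕ) :
    (boundedOddMaps α k).ncard = (2 * k + 1) ^ H.ncard := by
  have hset : boundedOddMaps α k =
      {f : α → ℤ | f.Odd ∧ H.domRestrict f ∈ {g | ∀ i, g i ∈ Finset.Icc (-(k : ℤ)) k}} := by
    ext f
    refine and_congr_right fun hf => (hH.natAbs_le_iff hf).trans ?_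
    simp only [Set.mem_ofPred_eq, mem_Icc_neg_natCast, Set.domRestrict_apply]
  rw [hset, hH.ncard_odd, ncard_forall_mem, Nat.card_coe_set_eq, Int.card_Icc]
  congr 1
  omega

lemma IsTransversal.ncard_boundedOddMaps_ne_zero [Finite α] {H : Set α} (hH : IsTransversal H)
    (hα : ∀ a : α, -a ≠ a) (k : ℕ) :
    {f ∈ boundedOddMaps α k | ∀ a, f a ≠ 0}.ncard = (2 * k) ^ H.ncard := by
  have hset : {f ∈ boundedOddMaps α k | ∀ a, f a ≠ 0} = {f : α → ℤ | f.Odd ∧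
      H.domRestrict f ∈ {g | ∀ i, g i ∈ (Finset.Icc (-(k : ℤ)) k).erase 0}} := by
    ext f
    rw [Set.mem_ofPred_eq, boundedOddMaps, Set.mem_ofPred_eq, and_assoc]
    refine and_congr_right fun hf => ?_
    rw [hH.natAbs_le_iff hf, hH.forall_ne_zero_iff hα hf, and_comm, ← forall_and]
    simp only [Set.mem_ofPred_eq, Finset.mem_erase, mem_Icc_neg_natCast, Set.domRestrict_apply]
  rw [hset, hH.ncard_odd, ncard_forall_mem, Nat.card_coe_set_eq,
    Finset.card_erase_of_mem (by simp), Int.card_Icc]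
  congr 1
  omega

lemma exists_ncard_injective_boundedOddMaps [Finite α]
    (hα : ∀ a b : α, -a = a → -b = b → a = b) :
    ∃ b, ∀ k, {f ∈ boundedOddMaps α k | f.Injective}.ncard = k.descFactorial b * 2 ^ b := by
  obtain ⟨H, hH⟩ := exists_isTransversal α
  refine ⟨Nat.card H, fun k => ?_⟩
  rw [← ncard_natAbs_injective k, ← hH.ncard_odd]
  congr 1
  ext f
  rw [Set.mem_ofPred_eq, boundedOddMaps, Set.mem_ofPred_eq, and_assoc]
  exact and_congr_right fun hf => and_congr (hH.natAbs_le_iff hf) (hH.odd_injective_iff hα hf)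

lemma exists_ncard_boundedOddMaps_fibres {α : Type*} [Neg α] [Finite β] {p : α → β}
    (hp : p.Surjective) (hneg : ∀ a, p (-a) = -p a)
    (hβ : ∀ a b : β, -a = a → -b = b → a = b) :
    ∃ b, ∀ k, {f ∈ boundedOddMaps α k | ∀ x y, f x = f y ↔ p x = p y}.ncard =
      k.descFactorial b * 2 ^ b := by
  obtain ⟨b, hb⟩ := exists_ncard_injective_boundedOddMaps hβ
  refine ⟨b, fun k => ?_⟩
  rw [← hb k, ← Set.ncard_image_of_injective _ hp.injective_comp_right]
  congr 1
  ext f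
  constructor
  · rintro ⟨⟨hodd, hle⟩, hfib⟩
    obtain ⟨g, rfl⟩ : ∃ g : β → ℤ, g ∘ p = f :=
      ⟨fun b => f (Function.surjInv hp b),
        funext fun a => (hfib _ _).2 (Function.surjInv_eq hp (p a))⟩
    refine ⟨g, ⟨⟨hp.forall.2 fun a => ?_, hp.forall.2 hle⟩, ?_⟩, rfl⟩
    · simpa [hneg] using hodd a
    · exact hp.forall₂.2 fun a b => (hfib a b).1
  · rintro ⟨g, ⟨⟨hodd, hle⟩, hinj⟩, rfl⟩
    refine ⟨⟨fun a => ?_, fun a => hle (p a)⟩, fun x y => hinj.eq_iff⟩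
    simp only [Function.comp_apply, hneg, hodd (p a)]

end InvolutiveNeg

end OddMaps

section Fibres

variable {n : ℕ} {π ρ : Finpartition (ground n)} {f : ground n → ℤ}

lemma mem_ground {x : ℤ} : x ∈ ground n ↔ x ≠ 0 ∧ x.natAbs ≤ n := by
  rw [ground, Finset.mem_erase, mem_Icc_neg_natCast]

lemma neg_mem_ground {x : ℤ} (hx : x ∈ ground n) : -x ∈ ground n := by
  rwa [mem_ground, neg_ne_zero, Int.natAbs_neg, ← mem_ground]

instance : InvolutiveNeg (ground n) where
  neg x := ⟨-x, neg_mem_ground x.2⟩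
  neg_neg x := Subtype.ext (neg_neg (x : ℤ))

lemma coe_neg_ground (x : ground n) : ((-x : ground n) : ℤ) = -x := rfl

lemma ground_neg_ne_self (x : ground n) : -x ≠ x := fun h => by
  have h : -(x : ℤ) = x := congrArg Subtype.val h
  have := (mem_ground.1 x.2).1
  omega

lemma isTransversal_ground_pos : IsTransversal {x : ground n | 0 < (x : ℤ)} where
  neg_notMem x hx := by
    rw [Set.mem_ofPred_eq] at hx
    rw [Set.mem_ofPred_eq, coe_neg_ground]
    omega
  mem_or_neg_mem x _ := by
    have := (mem_ground.1 x.2).1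
    rw [Set.mem_ofPred_eq, Set.mem_ofPred_eq, coe_neg_ground]
    omega

lemma ncard_ground_pos : {x : ground n | 0 < (x : ℤ)}.ncard = n := by
  have himage : Subtype.val '' {x : ground n | 0 < (x : ℤ)} = (Finset.Icc 1 (n : ℤ) : Set ℤ) := by
    ext x
    simp only [Set.mem_image, Set.mem_ofPred_eq, Subtype.exists, mem_ground, exists_and_left,
      exists_prop, exists_eq_right_right, Finset.coe_Icc, Set.mem_Icc]
    omega
  rw [← Set.ncard_image_of_injective _ Subtype.val_injective, himage, Set.ncard_coe_finset,
    Int.card_Icc]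
  omega

/-- The blocks of `π` are the fibres of `f`. -/
def IsKer (π : Finpartition (ground n)) (f : ground n → ℤ) : Prop :=
  ∀ x y, f x = f y ↔ π.part x = π.part y

lemma exists_part_eq {B : Finset ℤ} (hB : B ∈ π.parts) : ∃ x : ground n, π.part x = B := by
  obtain ⟨x, hx, rfl⟩ := π.part_surjOn hB
  exact ⟨⟨x, hx⟩, rfl⟩

lemma exists_isKer (f : ground n → ℤ) : ∃ π, IsKer π f := by
  classical
  let s : Setoid ℤ := Setoid.ker fun x => if hx : x ∈ ground n then f ⟨x, hx⟩ else 0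
  refine ⟨Finpartition.ofSetSetoid s (ground n), fun x y => ?_⟩
  rw [← Finpartition.mem_part_iff_part_eq_part _ x.2 y.2,
    Finpartition.mem_part_ofSetSetoid_iff_rel]
  simp [s, Setoid.ker_def, eq_comm]

namespace IsKer

lemma mem_part_iff (h : IsKer π f) {x y : ground n} : (y : ℤ) ∈ π.part x ↔ f y = f x := by
  rw [π.mem_part_iff_part_eq_part y.2 x.2, h]

lemma part_eq_part (hπ : IsKer π f) (hρ : IsKer ρ f) (x : ground n) : π.part x = ρ.part x := by
  ext y
  by_cases hy : y ∈ ground n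
  · exact (hπ.mem_part_iff (y := ⟨y, hy⟩)).trans hρ.mem_part_iff.symm
  · exact iff_of_false (fun h => hy (π.part_subset x h)) fun h => hy (ρ.part_subset x h)

lemma parts_subset (hπ : IsKer π f) (hρ : IsKer ρ f) : π.parts ⊆ ρ.parts := by
  intro B hB
  obtain ⟨x, rfl⟩ := exists_part_eq hB
  rw [hπ.part_eq_part hρ]
  exact ρ.part_mem.2 x.2

lemma unique (hπ : IsKer π f) (hρ : IsKer ρ f) : π = ρ :=
  Finpartition.ext ((hπ.parts_subset hρ).antisymm (hρ.parts_subset hπ))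

lemma part_neg (h : IsKer π f) (hf : f.Odd) (x : ground n) :
    π.part (-x : ground n) = -π.part x := by
  ext y
  rw [Finset.mem_neg']
  by_cases hy : y ∈ ground n
  · rw [h.mem_part_iff (y := ⟨y, hy⟩), hf, ← neg_eq_iff_eq_neg, ← hf]
    exact h.mem_part_iff.symm
  · refine iff_of_false (fun h => hy (π.part_subset _ h)) fun h => hy ?_
    simpa using neg_mem_ground (π.part_subset _ h)

lemma isZeroBlock_part (h : IsKer π f) (hf : f.Odd) (x : ground n) :
    IsZeroBlock (π.part x) ↔ f x = 0 := by
  rw [IsZeroBlock, ← h.part_neg hf, ← h, hf]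
  omega

lemma isBPartition (h : IsKer π f) (hf : f.Odd) : IsBPartition π := by
  refine ⟨fun B hB => ?_, fun B hB C hC zB zC => ?_⟩
  · obtain ⟨x, rfl⟩ := exists_part_eq hB
    rw [← h.part_neg hf]
    exact π.part_mem.2 (-x).2
  · obtain ⟨x, rfl⟩ := exists_part_eq hB
    obtain ⟨y, rfl⟩ := exists_part_eq hC
    rw [h.isZeroBlock_part hf] at zB zC
    rw [← h, zB, zC]

lemma forall_not_isZeroBlock_iff (h : IsKer π f) (hf : f.Odd) :
    (∀ B ∈ π.parts, ¬ IsZeroBlock B) ↔ ∀ x, f x ≠ 0 := by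
  refine ⟨fun hB x hx => hB _ (π.part_mem.2 x.2) ((h.isZeroBlock_part hf x).2 hx),
    fun hne B hB hz => ?_⟩
  obtain ⟨x, rfl⟩ := exists_part_eq hB
  exact hne x ((h.isZeroBlock_part hf x).1 hz)

end IsKer

lemma IsBPartition.part_neg (hπ : IsBPartition π) (x : ground n) :
    π.part (-x : ground n) = -π.part x := by
  refine π.part_eq_of_mem (hπ.1 _ (π.part_mem.2 x.2)) ?_
  rw [Finset.mem_neg', coe_neg_ground, neg_neg]
  exact π.mem_part x.2

lemma IsBPartition.exists_ncard_isKer (hπ : IsBPartition π) :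
    ∃ b, ∀ k, {f ∈ boundedOddMaps (ground n) k | IsKer π f}.ncard =
      k.descFactorial b * 2 ^ b := by
  let : InvolutiveNeg π.parts :=
    { neg := fun B => ⟨-B, hπ.1 _ B.2⟩
      neg_neg := fun B => Subtype.ext (neg_neg (B : Finset ℤ)) }
  let block (x : ground n) : π.parts := ⟨π.part x, π.part_mem.2 x.2⟩
  have block_surjective : block.Surjective := fun B =>
    (exists_part_eq B.2).imp fun _ hx => Subtype.ext hx
  have block_neg x : block (-x) = -block x := Subtype.ext (hπ.part_neg x)
  have zero_unique (B C : π.parts) (hB : -B = B) (hC : -C = C) : B = C :=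
    Subtype.ext (hπ.2 _ B.2 _ C.2 (congrArg Subtype.val hB.symm) (congrArg Subtype.val hC.symm))
  simpa only [IsKer, block, Subtype.mk.injEq] using
    exists_ncard_boundedOddMaps_fibres block_surjective block_neg zero_unique

open Classical in
lemma ncard_boundedOddMaps_eq_sum {P : Finpartition (ground n) → Prop}
    {Q : (ground n → ℤ) → Prop} (hPQ : ∀ π f, f.Odd → IsKer π f → (P π ↔ Q f)) (k : ℕ) :
    {f ∈ boundedOddMaps (ground n) k | Q f}.ncard =
      ∑ π : {π // P π}, {f ∈ boundedOddMaps (ground n) k | IsKer π.1 f}.ncard := by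
  rw [ncard_eq_sum_ncard_of_existsUnique (r := fun (π : {π // P π}) f => IsKer π.1 f)
    ((finite_boundedOddMaps k).subset (Set.sep_subset _ _))]
  · refine Finset.sum_congr rfl fun π _ => congrArg Set.ncard ?_
    ext f
    exact ⟨fun ⟨⟨hf, _⟩, h⟩ => ⟨hf, h⟩, fun ⟨hf, h⟩ => ⟨⟨hf, (hPQ _ _ hf.1 h).1 π.2⟩, h⟩⟩
  · rintro f ⟨hf, hQ⟩
    obtain ⟨π, hπ⟩ := exists_isKer f
    exact ⟨⟨π, (hPQ _ _ hf.1 hπ).2 hQ⟩, hπ, fun ρ hρ => Subtype.ext (hρ.unique hπ)⟩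

end Fibres

section Poisson

open ProbabilityTheory MeasureTheory
open scoped NNReal Nat

lemma integral_poissonMeasure_natCast_mul (r : ℝ≥0) (g : ℕ → ℝ) :
    ∫ k, k * g k ∂poissonMeasure r = r * ∫ k, g (k + 1) ∂poissonMeasure r := by
  have hsupp : Function.support (fun k : ℕ => (Real.exp (-r) * r ^ k / k !) • (k * g k)) ⊆
      Set.range Nat.succ := by
    rintro (_ | k) hk
    · simp at hk
    · exact ⟨k, rfl⟩
  rw [integral_poissonMeasure, integral_poissonMeasure, ← tsum_mul_left,
    ← Nat.succ_injective.tsum_eq hsupp]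
  refine tsum_congr fun k => ?_
  simp only [Nat.succ_eq_add_one, Nat.factorial_succ, smul_eq_mul]
  push_cast
  field_simp
  ring

lemma integral_poissonMeasure_descFactorial (r : ℝ≥0) (b : ℕ) :
    ∫ k, (k.descFactorial b : ℝ) ∂poissonMeasure r = r ^ b := by
  induction b with
  | zero => simp
  | succ b ih =>
    have hrec (k : ℕ) : (k.descFactorial (b + 1) : ℝ) = k * ((k - 1).descFactorial b : ℝ) := by
      cases k with
      | zero => simp
      | succ k => rw [Nat.succ_descFactorial_succ, Nat.cast_mul, Nat.add_sub_cancel]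
    simp_rw [hrec, integral_poissonMeasure_natCast_mul r fun k => ((k - 1).descFactorial b : ℝ),
      Nat.add_sub_cancel, ih, pow_succ']

lemma integrable_exp_mul_poissonMeasure (r : ℝ≥0) (t : ℝ) :
    Integrable (fun k : ℕ => Real.exp (t * k)) (poissonMeasure r) := by
  rw [integrable_poissonMeasure_iff]
  refine ((Real.summable_pow_div_factorial (r * Real.exp t)).mul_left (Real.exp (-r))).congr
    fun k => ?_
  rw [Real.norm_of_nonneg (Real.exp_pos _).le, mul_comm t, Real.exp_nat_mul]
  ring

lemma integrable_affine_pow_poissonMeasure (r : ℝ≥0) (a c : ℝ) (n : ℕ) :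
    Integrable (fun k : ℕ => (a * k + c) ^ n) (poissonMeasure r) := by
  have hexp (t : ℝ) : Integrable (fun k : ℕ => Real.exp (t * (a * k + c))) (poissonMeasure r) := by
    simpa only [mul_add, Real.exp_add, mul_assoc] using
      (integrable_exp_mul_poissonMeasure r (t * a)).mul_const (Real.exp (t * c))
  exact integrable_pow_of_integrable_exp_mul one_ne_zero (hexp 1) (hexp (-1)) n

lemma integrable_descFactorial_poissonMeasure (r : ℝ≥0) (b : ℕ) :
    Integrable (fun k : ℕ => (k.descFactorial b : ℝ)) (poissonMeasure r) := by
  refine (integrable_affine_pow_poissonMeasure r 1 0 b).mono' .of_discrete (.of_forall fun k => ?_)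
  rw [Real.norm_natCast, one_mul, add_zero]
  exact_mod_cast k.descFactorial_le_pow b

lemma card_eq_integral_ncard {n : ℕ} {P : Finpartition (ground n) → Prop}
    {Q : (ground n → ℤ) → Prop} (hP : ∀ π, P π → IsBPartition π)
    (hPQ : ∀ π f, f.Odd → IsKer π f → (P π ↔ Q f)) :
    (Nat.card {π // P π} : ℝ) =
      ∫ k, ({f ∈ boundedOddMaps (ground n) k | Q f}.ncard : ℝ) ∂poissonMeasure (1 / 2) := by
  classical
  choose b hb using fun π : {π // P π} => (hP π π.2).exists_ncard_isKer
  simp_rw [ncard_boundedOddMaps_eq_sum hPQ, hb, Nat.cast_sum, Nat.cast_mul, Nat.cast_pow,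
    Nat.cast_ofNat]
  have hint π : Integrable (fun k : ℕ => k.descFactorial (b π) * (2 : ℝ) ^ b π)
      (poissonMeasure (1 / 2)) := (integrable_descFactorial_poissonMeasure _ _).mul_const _
  have hexpect π :
      ∫ k, k.descFactorial (b π) * (2 : ℝ) ^ b π ∂poissonMeasure (1 / 2) = 1 := by
    rw [integral_mul_const, integral_poissonMeasure_descFactorial, ← mul_pow]
    norm_num
  rw [integral_finsetSum _ fun π _ => hint π]
  simp only [hexpect, Finset.sum_const, Finset.card_univ, nsmul_eq_mul, mul_one,
    Nat.card_eq_fintype_card]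

/-- `E[(2K + c) ^ n]` for a Poisson variable `K` with mean `1 / 2`. -/
noncomputable def moment (c : ℝ) (n : ℕ) : ℝ :=
  ∫ k, (2 * k + c) ^ n ∂poissonMeasure (1 / 2)

lemma M_eq_moment (n : ℕ) : (M n : ℝ) = moment 1 n := by
  rw [M, card_eq_integral_ncard (Q := fun _ => True) (fun _ h => h)
    fun π f hf h => iff_true_intro (h.isBPartition hf)]
  simp only [and_true, Set.ofPred_mem_eq, isTransversal_ground_pos.ncard_boundedOddMaps,
    ncard_ground_pos, moment, Nat.cast_pow, Nat.cast_add, Nat.cast_mul, Nat.cast_ofNat,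
    Nat.cast_one]

lemma N_eq_moment (n : ℕ) : (N n : ℝ) = moment 0 n := by
  rw [N, card_eq_integral_ncard (Q := fun f => ∀ x, f x ≠ 0) (fun _ h => h.1)
    fun π f hf h => (and_iff_right (h.isBPartition hf)).trans (h.forall_not_isZeroBlock_iff hf)]
  simp only [isTransversal_ground_pos.ncard_boundedOddMaps_ne_zero ground_neg_ne_self,
    ncard_ground_pos, moment, Nat.cast_pow, Nat.cast_mul, Nat.cast_ofNat, add_zero]

-- Jensen's inequality for the measure `Y ^ (m + 1) • μ`, under which `1 / Y` has mean `v`: the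
-- tangent line of `t ↦ (1 + σ * t) ^ (m + 1)` at `v` is integrated without dividing by `Y`.
lemma pow_mul_integral_pow_le_integral_add_pow {Ω : Type*} [MeasurableSpace Ω] {μ : Measure Ω}
    {Y : Ω → ℝ} {σ v : ℝ} {m : ℕ} (hY : ∀ ω, 0 ≤ Y ω) (hYσ : ∀ ω, 0 ≤ Y ω + σ)
    (hσv : 0 ≤ 1 + σ * v) (hint : Integrable (fun ω => Y ω ^ m) μ)
    (hint_succ : Integrable (fun ω => Y ω ^ (m + 1)) μ)
    (hint_add : Integrable (fun ω => (Y ω + σ) ^ (m + 1)) μ)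
    (hv : ∫ ω, Y ω ^ m ∂μ = v * ∫ ω, Y ω ^ (m + 1) ∂μ) :
    (1 + σ * v) ^ (m + 1) * ∫ ω, Y ω ^ (m + 1) ∂μ ≤ ∫ ω, (Y ω + σ) ^ (m + 1) ∂μ := by
  have tangent (ω : Ω) : (1 + σ * v) ^ (m + 1) * Y ω ^ (m + 1) +
      (m + 1) * (1 + σ * v) ^ m * σ * (Y ω ^ m - v * Y ω ^ (m + 1)) ≤ (Y ω + σ) ^ (m + 1) := by
    have hpos := mul_nonneg hσv (hY ω)
    have h := pow_add_mul_le_add_pow (b := σ * (1 - v * Y ω)) hpos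
      (by linarith [hYσ ω]) (m + 1)
    calc _ = ((1 + σ * v) * Y ω) ^ (m + 1) + (m + 1 : ℕ) * ((1 + σ * v) * Y ω) ^ (m + 1 - 1) *
          (σ * (1 - v * Y ω)) := by
          rw [Nat.add_sub_cancel, mul_pow, mul_pow]
          push_cast
          ring
      _ ≤ _ := h
      _ = _ := by ring
  have hdiff : Integrable (fun ω => Y ω ^ m - v * Y ω ^ (m + 1)) μ :=
    hint.sub (hint_succ.const_mul v)
  have hcancel : ∫ ω, (Y ω ^ m - v * Y ω ^ (m + 1)) ∂μ = 0 := by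
    rw [integral_sub hint (hint_succ.const_mul v), integral_const_mul, hv, sub_self]
  have h := integral_mono ((hint_succ.const_mul _).add (hdiff.const_mul _)) hint_add tangent
  simp only [Pi.add_apply] at h
  rwa [integral_add (hint_succ.const_mul _) (hdiff.const_mul _), integral_const_mul,
    integral_const_mul, hcancel, mul_zero, add_zero] at h

/-- The ratio `E[(2K + c) ^ (n + 1)] / E[(2K + c) ^ n]` of consecutive moments. -/
noncomputable def momentRatio (c : ℝ) (n : ℕ) : ℝ := moment c (n + 1) / moment c n

lemma integrable_moment (c : ℝ) (n : ℕ) :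
    Integrable (fun k : ℕ => (2 * k + c) ^ n) (poissonMeasure (1 / 2)) :=
  integrable_affine_pow_poissonMeasure _ 2 c n

lemma moment_add_two (c : ℝ) (n : ℕ) :
    moment (c + 2) n = moment c (n + 1) - c * moment c n := by
  have hstein := integral_poissonMeasure_natCast_mul (1 / 2) fun k => (2 * k + c) ^ n
  have hshift : moment (c + 2) n =
      ∫ k : ℕ, (2 * ((k + 1 : ℕ) : ℝ) + c) ^ n ∂poissonMeasure (1 / 2) := by
    refine integral_congr_ae (.of_forall fun k => ?_)
    push_cast
    ring
  have hsplit (k : ℕ) : (k : ℝ) * (2 * k + c) ^ n =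
      1 / 2 * ((2 * k + c) ^ (n + 1) - c * (2 * k + c) ^ n) := by ring
  simp_rw [hsplit] at hstein
  rw [integral_const_mul,
    integral_sub (integrable_moment c _) ((integrable_moment c n).const_mul c),
    integral_const_mul, ← hshift] at hstein
  simp only [moment] at hstein ⊢
  push_cast at hstein
  linarith

section

variable {c : ℝ} (hc : 0 ≤ c)
include hc

lemma moment_pos (n : ℕ) : 0 < moment c n := by
  have hnonneg (k : ℕ) : 0 ≤ (2 * (k : ℝ) + c) ^ n := by positivity
  refine (integral_pos_iff_support_of_nonneg hnonneg (integrable_moment c n)).2 ?_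
  have hone : ({1} : Set ℕ) ⊆ Function.support fun k : ℕ => (2 * (k : ℝ) + c) ^ n :=
    Set.singleton_subset_iff.2 (by rw [Function.mem_support]; positivity)
  have hmass := poissonMeasure_real_singleton_pos (r := 1 / 2) 1 (by norm_num)
  exact (ENNReal.toReal_pos_iff.1 hmass).1.trans_le (measure_mono hone)

lemma moment_succ_eq (n : ℕ) : moment c (n + 1) = momentRatio c n * moment c n :=
  (div_mul_cancel₀ _ (moment_pos hc n).ne').symm

lemma moment_add_two_eq (n : ℕ) : moment (c + 2) n = (momentRatio c n - c) * moment c n := by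
  rw [moment_add_two, moment_succ_eq hc]
  ring

lemma lt_momentRatio (n : ℕ) : c < momentRatio c n := by
  have h := moment_pos (c := c + 2) (by positivity) n
  rw [moment_add_two_eq hc] at h
  exact sub_pos.1 (pos_of_mul_pos_left h (moment_pos hc n).le)

lemma momentRatio_mono : Monotone (momentRatio c) := by
  refine monotone_nat_of_le_succ fun n => ?_
  set r := momentRatio c n
  have hnonneg : 0 ≤ ∫ k : ℕ, (2 * k + c) ^ n * (2 * k + c - r) ^ 2 ∂poissonMeasure (1 / 2) :=
    integral_nonneg fun k => by positivity
  have hexpand (k : ℕ) : (2 * (k : ℝ) + c) ^ n * (2 * k + c - r) ^ 2 =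
      (2 * k + c) ^ (n + 2) - (2 * r * (2 * k + c) ^ (n + 1) - r ^ 2 * (2 * k + c) ^ n) := by ring
  have hint (a : ℝ) (j : ℕ) := (integrable_moment c j).const_mul a
  have hint_sub : Integrable (fun k : ℕ => 2 * r * (2 * k + c) ^ (n + 1) - r ^ 2 * (2 * k + c) ^ n)
      (poissonMeasure (1 / 2)) := (hint _ _).sub (hint _ _)
  simp_rw [hexpand] at hnonneg
  rw [integral_sub (integrable_moment c _) hint_sub, integral_sub (hint _ _) (hint _ _),
    integral_const_mul, integral_const_mul] at hnonneg
  change 0 ≤ moment c (n + 2) - (2 * r * moment c (n + 1) - r ^ 2 * moment c n) at hnonneg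
  rw [momentRatio, le_div_iff₀ (moment_pos hc _)]
  linear_combination hnonneg - r * moment_succ_eq hc n

lemma momentRatio_le_momentRatio_add_two (n : ℕ) : momentRatio c n ≤ momentRatio (c + 2) n := by
  have hc2 : 0 ≤ c + 2 := by positivity
  rw [momentRatio.eq_1 (c + 2), le_div_iff₀ (moment_pos hc2 n), moment_add_two_eq hc,
    moment_add_two_eq hc, moment_succ_eq hc, ← mul_assoc, ← mul_assoc, mul_comm (_ - c)]
  exact mul_le_mul_of_nonneg_right (mul_le_mul_of_nonneg_left
    (sub_le_sub_right (momentRatio_mono hc n.le_succ) c)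
    (hc.trans (lt_momentRatio hc n).le)) (moment_pos hc n).le

lemma mul_le_log_moment_sub_log_moment {σ : ℝ} (hcσ : 0 ≤ c + σ) {m : ℕ}
    (hσ : 0 < momentRatio c m + σ) :
    (m + 1) * (σ / (momentRatio c m + σ)) ≤
      Real.log (moment (c + σ) (m + 1)) - Real.log (moment c (m + 1)) := by
  set r := momentRatio c m
  have hr_pos : 0 < r := hc.trans_lt (lt_momentRatio hc m)
  have hfactor : 1 + σ * r⁻¹ = (r + σ) / r := by field_simp
  have hfactor_pos : 0 < 1 + σ * r⁻¹ := hfactor ▸ div_pos hσ hr_pos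
  have hjensen : (1 + σ * r⁻¹) ^ (m + 1) * moment c (m + 1) ≤ moment (c + σ) (m + 1) := by
    simp only [moment, ← add_assoc]
    refine pow_mul_integral_pow_le_integral_add_pow (fun k => by positivity)
      (fun k => by linarith [k.cast_nonneg (α := ℝ)])
      hfactor_pos.le (integrable_moment c m) (integrable_moment c _)
      (by simpa only [add_assoc] using integrable_moment (c + σ) (m + 1)) ?_
    change moment c m = r⁻¹ * moment c (m + 1)
    rw [moment_succ_eq hc, inv_mul_cancel_left₀ hr_pos.ne']
  have hlog := Real.log_le_log (mul_pos (pow_pos hfactor_pos _) (moment_pos hc _)) hjensen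
  rw [Real.log_mul (pow_pos hfactor_pos _).ne' (moment_pos hc _).ne', Real.log_pow] at hlog
  have htangent := Real.one_sub_inv_le_log_of_pos hfactor_pos
  have hinv : 1 - (1 + σ * r⁻¹)⁻¹ = σ / (r + σ) := by
    rw [hfactor, inv_div]
    field_simp
    ring
  rw [hinv] at htangent
  calc _ ≤ ((m + 1 : ℕ) : ℝ) * Real.log (1 + σ * r⁻¹) := by
        push_cast
        gcongr
    _ ≤ _ := by linarith

lemma log_moment_add_two_sub_log_moment (n : ℕ) :
    Real.log (moment (c + 2) n) - Real.log (moment c n) = Real.log (momentRatio c n - c) := by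
  rw [moment_add_two_eq hc, Real.log_mul (sub_pos.2 (lt_momentRatio hc n)).ne'
    (moment_pos hc n).ne', add_sub_cancel_right]

lemma two_mul_succ_le_mul_log_momentRatio (m : ℕ) :
    2 * ((m : ℝ) + 1) ≤ (momentRatio c (m + 1) + 2) * Real.log (momentRatio c (m + 1)) := by
  have hr : c < momentRatio c m := lt_momentRatio hc m
  have hq : c < momentRatio c (m + 1) := lt_momentRatio hc (m + 1)
  have hmono : momentRatio c m ≤ momentRatio c (m + 1) := momentRatio_mono hc m.le_succ
  have hlog : (m + 1) * (2 / (momentRatio c m + 2)) ≤ Real.log (momentRatio c (m + 1)) :=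
    calc _ ≤ Real.log (momentRatio c (m + 1) - c) := by
          rw [← log_moment_add_two_sub_log_moment hc]
          exact mul_le_log_moment_sub_log_moment hc (by linarith) (by linarith)
      _ ≤ _ := Real.log_le_log (by linarith) (by linarith)
  have hr2 : 0 < momentRatio c m + 2 := by linarith
  have hlog_nonneg : 0 ≤ Real.log (momentRatio c (m + 1)) := le_trans (by positivity) hlog
  rw [← mul_div_assoc, div_le_iff₀ hr2] at hlog
  calc _ ≤ (momentRatio c m + 2) * Real.log (momentRatio c (m + 1)) := by linarith
    _ ≤ _ := by gcongr

lemma mul_log_momentRatio_le {m : ℕ} (hm : c + 1 ≤ momentRatio c m) :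
    (momentRatio c m - 2) * Real.log (momentRatio c m - c) ≤ 2 * (m + 1) := by
  have hc2 : 0 ≤ c + 2 := by positivity
  have hs : 0 < momentRatio (c + 2) m - 2 := by linarith [lt_momentRatio hc2 m]
  have hlog : Real.log (momentRatio c (m + 1) - c) ≤
      (m + 1) * (2 / (momentRatio (c + 2) m - 2)) := by
    have h := mul_le_log_moment_sub_log_moment hc2 (σ := -2) (by linarith) hs
    rw [add_neg_cancel_right, ← sub_eq_add_neg, neg_div, mul_neg] at h
    linarith [log_moment_add_two_sub_log_moment hc (m + 1)]
  rw [← mul_div_assoc, le_div_iff₀ hs] at hlog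
  have hmono : momentRatio c m ≤ momentRatio c (m + 1) := momentRatio_mono hc m.le_succ
  calc _ ≤ (momentRatio (c + 2) m - 2) * Real.log (momentRatio c (m + 1) - c) := by
        gcongr
        · exact Real.log_nonneg (by linarith)
        · exact momentRatio_le_momentRatio_add_two hc m
        · linarith
    _ ≤ _ := by linarith

end

end Poisson

section Asymptotics

open Asymptotics Filter
open scoped Topology

lemma isEquivalent_of_le_of_le {α : Type*} {l : Filter α} {f g h k : α → ℝ} (hf : f ~[l] k)
    (hh : h ~[l] k) (hfg : f ≤ᶠ[l] g) (hgh : g ≤ᶠ[l] h) : g ~[l] k := by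
  refine isLittleO_iff.2 fun ε hε => ?_
  filter_upwards [isLittleO_iff.1 hf hε, isLittleO_iff.1 hh hε, hfg, hgh] with x hfx hhx hfgx hghx
  simp only [Pi.sub_apply, Real.norm_eq_abs, abs_le] at hfx hhx ⊢
  constructor <;> linarith

lemma isEquivalent_log_const_mul {a : ℝ} (ha : 0 < a) :
    (fun x => Real.log (a * x)) ~[atTop] Real.log := by
  refine IsEquivalent.congr_left ?_ ((eventually_gt_atTop 0).mono fun x hx =>
    (Real.log_mul ha.ne' hx.ne').symm)
  exact Real.isLittleO_const_log_atTop.add_isEquivalent .refl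

lemma isEquivalent_sqrt {α : Type*} {l : Filter α} {f g : α → ℝ} (hg : 0 ≤ g) (hfg : f ~[l] g) :
    (fun x => √(f x)) ~[l] fun x => √(g x) := by
  simp only [Real.sqrt_eq_rpow]
  exact hfg.rpow hg

section MulLog

variable {α : Type*} {l : Filter α} {q u : α → ℝ} (hq : Tendsto q l atTop)
  (hu : (fun x => u x - q x * Real.log (q x)) =O[l] fun x => Real.log (q x))
include hq hu

lemma isEquivalent_mul_log : u ~[l] fun x => q x * Real.log (q x) := by
  refine hu.trans_isLittleO ?_
  have hone : (fun _ => 1 : α → ℝ) =o[l] q :=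
    isLittleO_const_left.2 (.inr (tendsto_norm_atTop_atTop.comp hq))
  simpa only [one_mul] using hone.mul_isBigO (isBigO_refl (fun x => Real.log (q x)) l)

lemma isEquivalent_div_log : q ~[l] fun x => u x / Real.log (u x) := by
  have hlog_top : Tendsto (fun x => Real.log (q x)) l atTop := Real.tendsto_log_atTop.comp hq
  have huq : u ~[l] fun x => q x * Real.log (q x) := isEquivalent_mul_log hq hu
  have hloglog : (fun x => Real.log (Real.log (q x))) =o[l] fun x => Real.log (q x) :=
    Real.isLittleO_log_id_atTop.comp_tendsto hlog_top
  have hlog_mul : (fun x => Real.log (q x * Real.log (q x))) ~[l] fun x => Real.log (q x) := by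
    refine (IsEquivalent.refl.add_isLittleO hloglog).congr_left ?_
    filter_upwards [hq.eventually_gt_atTop 0, hlog_top.eventually_gt_atTop 0] with x hx hx'
    exact (Real.log_mul hx.ne' hx'.ne').symm
  have hlog : (fun x => Real.log (u x)) ~[l] fun x => Real.log (q x) :=
    (huq.log (hq.atTop_mul_atTop₀ hlog_top)).trans hlog_mul
  refine ((huq.div hlog).congr_right ?_).symm
  filter_upwards [hlog_top.eventually_gt_atTop 0] with x hx
  exact mul_div_cancel_right₀ _ hx.ne'

lemma tendsto_div_add_sub_log (d : ℝ) :
    Tendsto (fun x => u x / (q x + d) - Real.log (q x)) l (𝓝 0) := by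
  have hqd : Tendsto (fun x => q x + d) l atTop := tendsto_atTop_add_const_right l d hq
  have hO : (fun x => u x - q x * Real.log (q x) - d * Real.log (q x)) =O[l]
      fun x => Real.log (q x) := hu.sub (isBigO_const_mul_self d _ l)
  have ho : (fun x => Real.log (q x)) =o[l] fun x => q x + d :=
    (Real.isLittleO_log_id_atTop.comp_tendsto hq).trans_isBigO
      (IsEquivalent.refl.add_isLittleO (isLittleO_const_left.2
        (.inr (tendsto_norm_atTop_atTop.comp hq)))).isBigO_symm
  refine (hO.trans_isLittleO ho).tendsto_div_nhds_zero.congr' ?_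
  filter_upwards [hqd.eventually_gt_atTop 0] with x hx
  field_simp
  ring

lemma isEquivalent_exp_neg_div (d : ℝ) :
    (fun x => Real.exp (-(u x / (q x + d) / 2))) ~[l] fun x => √(Real.log (u x) / u x) := by
  have hexp : (fun x => Real.exp (-(u x / (q x + d)))) ~[l] fun x => (q x)⁻¹ := by
    refine isEquivalent_of_tendsto_one ?_
    have h := (Real.continuous_exp.tendsto _).comp (tendsto_div_add_sub_log hq hu d).neg
    rw [neg_zero, Real.exp_zero] at h
    refine h.congr' ?_
    filter_upwards [hq.eventually_gt_atTop 0] with x hx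
    rw [Function.comp_apply, Pi.div_apply, div_inv_eq_mul, neg_sub', sub_neg_eq_add, Real.exp_add,
      Real.exp_log hx]
  have hinv : (fun x => Real.exp (-(u x / (q x + d)))) ~[l] fun x => Real.log (u x) / u x :=
    hexp.trans ((isEquivalent_div_log hq hu).inv.congr_right (.of_forall fun x => inv_div _ _))
  simp_rw [← neg_div, Real.exp_half]
  exact (isEquivalent_sqrt (fun x => (Real.exp_pos _).le)
    (by simpa only [neg_div] using hinv.symm)).symm

end MulLog

lemma tendsto_momentRatio_atTop {c : ℝ} (hc : 0 ≤ c) : Tendsto (momentRatio c) atTop atTop := by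
  refine (tendsto_add_atTop_iff_nat 1).1 (tendsto_atTop_mono (f := fun m : ℕ => √m - 2) ?_ ?_)
  · intro m
    have hpos : 0 < momentRatio c (m + 1) := hc.trans_lt (lt_momentRatio hc _)
    rw [sub_le_iff_le_add, Real.sqrt_le_left (by positivity)]
    have hlog : Real.log (momentRatio c (m + 1)) ≤ momentRatio c (m + 1) + 2 := by
      linarith [Real.log_le_sub_one_of_pos hpos]
    calc (m : ℝ) ≤ 2 * (m + 1) := by linarith [m.cast_nonneg (α := ℝ)]
      _ ≤ _ := two_mul_succ_le_mul_log_momentRatio hc m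
      _ ≤ _ := by rw [sq]; gcongr
  · exact tendsto_atTop_add_const_right _ _
      (Real.tendsto_sqrt_atTop.comp tendsto_natCast_atTop_atTop)

lemma mul_log_sub_log_le {c r : ℝ} (hc : 0 ≤ c) (hr : 2 * c ≤ r) (hcr : c < r) :
    r * (Real.log r - Real.log (r - c)) ≤ 2 * c := by
  have hr_pos : 0 < r := hc.trans_lt hcr
  have hsub : 0 < r - c := sub_pos.2 hcr
  rw [← Real.log_div hr_pos.ne' hsub.ne']
  calc _ ≤ r * (r / (r - c) - 1) := by
        gcongr
        exact Real.log_le_sub_one_of_pos (by positivity)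
    _ = r * c / (r - c) := by field_simp; ring
    _ ≤ 2 * c := by rw [div_le_iff₀ hsub]; nlinarith

lemma isBigO_two_mul_succ_sub_mul_log {c : ℝ} (hc : 0 ≤ c) :
    (fun m : ℕ => 2 * ((m : ℝ) + 1) - momentRatio c m * Real.log (momentRatio c m)) =O[atTop]
      fun m => Real.log (momentRatio c m) := by
  have hr_top : Tendsto (momentRatio c) atTop atTop := tendsto_momentRatio_atTop hc
  refine IsBigO.of_bound (4 + 2 * c) ?_
  filter_upwards [eventually_ge_atTop 1, hr_top.eventually_ge_atTop (2 * c),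
    hr_top.eventually_ge_atTop (c + 1),
    (Real.tendsto_log_atTop.comp hr_top).eventually_ge_atTop 1] with m hm h2c hc1 hlog
  have hupper : 2 * (m : ℝ) ≤ (momentRatio c m + 2) * Real.log (momentRatio c m) := by
    obtain ⟨k, rfl⟩ := Nat.exists_eq_add_of_le' hm
    exact_mod_cast two_mul_succ_le_mul_log_momentRatio hc k
  have hlower := mul_log_momentRatio_le hc hc1
  have hshift := mul_log_sub_log_le hc h2c (by linarith)
  have hsub : Real.log (momentRatio c m - c) ≤ Real.log (momentRatio c m) :=
    Real.log_le_log (by linarith) (by linarith)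
  have hc_log : c ≤ c * Real.log (momentRatio c m) := le_mul_of_one_le_right hc hlog
  rw [Function.comp_apply] at hlog
  rw [Real.norm_eq_abs, Real.norm_of_nonneg (by linarith), abs_le]
  constructor <;> linarith

lemma isEquivalent_exp_neg_div_momentRatio {c : ℝ} (hc : 0 ≤ c) (d : ℝ) :
    (fun m : ℕ => Real.exp (-((m + 1) / (momentRatio c m + d)))) ~[atTop]
      fun m => √(Real.log (m + 1) / (2 * (m + 1))) := by
  have htop : Tendsto (fun m : ℕ => (m : ℝ) + 1) atTop atTop :=
    tendsto_atTop_add_const_right _ _ tendsto_natCast_atTop_atTop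
  have hlog := (isEquivalent_log_const_mul two_pos).comp_tendsto htop
  refine IsEquivalent.trans (v := fun m : ℕ => √(Real.log (2 * (m + 1)) / (2 * (m + 1)))) ?_
    (isEquivalent_sqrt (fun m => ?_) (hlog.div .refl))
  · refine (isEquivalent_exp_neg_div (tendsto_momentRatio_atTop hc)
      (isBigO_two_mul_succ_sub_mul_log hc) d).congr_left (.of_forall fun m => ?_)
    ring_nf
  · have := Real.log_nonneg (le_add_of_nonneg_left m.cast_nonneg : (1 : ℝ) ≤ m + 1)
    positivity

lemma exp_neg_le_N_div_M (m : ℕ) :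
    Real.exp (-((m + 1) / (momentRatio 1 m + -1))) ≤ N (m + 1) / M (m + 1) := by
  have hpos : 0 < momentRatio 1 m + -1 := by linarith [lt_momentRatio zero_le_one m]
  have h := mul_le_log_moment_sub_log_moment zero_le_one (σ := -1) (by norm_num) hpos
  rw [add_neg_cancel, neg_div, mul_neg, mul_one_div] at h
  have hN := moment_pos le_rfl (m + 1)
  have hM := moment_pos zero_le_one (m + 1)
  rwa [N_eq_moment, M_eq_moment, ← Real.le_log_iff_exp_le (div_pos hN hM),
    Real.log_div hN.ne' hM.ne']

lemma N_div_M_le_exp_neg (m : ℕ) :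
    (N (m + 1) / M (m + 1) : ℝ) ≤ Real.exp (-((m + 1) / (momentRatio 0 m + 1))) := by
  have hpos : 0 < momentRatio 0 m + 1 := by linarith [lt_momentRatio le_rfl m]
  have h := mul_le_log_moment_sub_log_moment le_rfl (σ := 1) (by norm_num) hpos
  rw [zero_add, mul_one_div] at h
  have hN := moment_pos le_rfl (m + 1)
  have hM := moment_pos zero_le_one (m + 1)
  rw [N_eq_moment, M_eq_moment, ← Real.log_le_iff_le_exp (div_pos hN hM),
    Real.log_div hN.ne' hM.ne']
  linarith

end Asymptotics

end TypeB

theorem mainTheorem7 :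
    Asymptotics.IsEquivalent Filter.atTop
      (fun n : ℕ => (TypeB.N n : ℝ) / (TypeB.M n : ℝ))
      (fun n : ℕ => Real.sqrt (Real.log (n : ℝ) / (2 * (n : ℝ)))) := by
  rw [← Filter.map_add_atTop_eq_nat 1, Asymptotics.isEquivalent_map]
  refine TypeB.isEquivalent_of_le_of_le ?_ ?_ (.of_forall TypeB.exp_neg_le_N_div_M)
    (.of_forall TypeB.N_div_M_le_exp_neg)
  · simpa only [Function.comp_def, Nat.cast_add_one] using
      TypeB.isEquivalent_exp_neg_div_momentRatio zero_le_one (-1)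
  · simpa only [Function.comp_def, Nat.cast_add_one] using
      TypeB.isEquivalent_exp_neg_div_momentRatio le_rfl 1
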